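/- A quantum query algorithm in the adjacency matrix model with $T$ queries acts on a finite-dimensional space with basis $|e\rangle|q\rangle|w\rangle$, where $e$ ranges over the unordered pairs of distinct vertices, $q\in\{0,1\}$, and $w$ ranges over an arbitrary finite set. On an input graph $G$ it starts in a fixed basis state, applies $U_T O_G U_{T-1} O_G\cdots O_G U_0$, where the unitaries $U_0,\dots,U_T$ do not depend on $G$ and $O_G|e\rangle|q\rangle|w\rangle=|e\rangle|q\oplus E_G(e)\rangle|w\rangle$ with $E_G(e)=1$ if and only if $e$ is an edge of $G$, and reads its output off a measurement in the computational basis. It decides a graph property with bounded error if on every graph on the given vertex set it outputs the correct answer with probability at least $2/3$. **Theorem.** For every constant $\epsilon>0$ there are a constant $c>0$ and an integer $n_0$, both depending only on $\epsilon$, such that for all integers $n\ge n_0$ and $0\le k\le(1-\epsilon)n$, every quantum query algorithm in the adjacency matrix model that decides with bounded error whether a simple undirected graph on $n$ vertices has a vertex cover of size at most $k$ makes at least $c\sqrt{k}\,n$ queries. That is, the bounded-error quantum query complexity of this problem is $\Omega(\sqrt{k}\,n)$. -/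

import Mathlib

/-- The unordered pairs of distinct elements of `V`: the positions that may be queried in the
adjacency matrix model. -/
abbrev VertexPair (V : Type) : Type := {e : Sym2 V // ¬ e.IsDiag}

/-- The computational basis of the state space of a quantum query algorithm: a query register
`|i⟩` with `i : I`, a query answer qubit `|q⟩`, and a work register `|w⟩` with `w : W`. -/
abbrev QueryBasis (I W : Type) : Type := I × Bool × W

/-- The query operator of the input `x : I → Bool`, as a matrix in the computational basis:
`|i⟩|q⟩|w⟩ ↦ |i⟩|q ⊕ x i⟩|w⟩`. -/
def queryOracle {I W : Type} [DecidableEq I] [DecidableEq W] (x : I → Bool) :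
    Matrix (QueryBasis I W) (QueryBasis I W) ℂ :=
  Matrix.of fun r s => if r = (s.1, s.2.1 ^^ x s.1, s.2.2) then 1 else 0

/-- A quantum query algorithm making `T` queries to an input `x : I → Bool`, with Boolean output:
input-independent unitaries `U 0, …, U T`, an initial basis state, and the output that is read off
when the final state is measured in the computational basis. -/
structure QuantumQueryAlgorithm (I W : Type) [Fintype I] [DecidableEq I] [Fintype W]
    [DecidableEq W] (T : ℕ) where
  /-- the basis state in which the algorithm starts -/
  start : QueryBasis I W
  /-- the unitaries applied before, between and after the queries -/
  U : Fin (T + 1) → Matrix.unitaryGroup (QueryBasis I W) ℂ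
  /-- the output belonging to each measurement result -/
  output : QueryBasis I W → Bool

namespace QuantumQueryAlgorithm

variable {I W : Type} [Fintype I] [DecidableEq I] [Fintype W] [DecidableEq W] {T : ℕ}

/-- The state after `U t` on input `x`, that is `U t · O · U (t-1) ⋯ O · U 0 |start⟩`. -/
def state (A : QuantumQueryAlgorithm I W T) (x : I → Bool) (t : Fin (T + 1)) :
    QueryBasis I W → ℂ :=
  Fin.induction (motive := fun _ => QueryBasis I W → ℂ)
    (Matrix.mulVec (A.U 0 : Matrix (QueryBasis I W) (QueryBasis I W) ℂ) (Pi.single A.start 1))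
    (fun i ψ => Matrix.mulVec (A.U i.succ : Matrix (QueryBasis I W) (QueryBasis I W) ℂ)
      (Matrix.mulVec (queryOracle x) ψ)) t

/-- The probability that the algorithm outputs `b` on input `x`: the final state is measured in
the computational basis. -/
noncomputable def outputProb (A : QuantumQueryAlgorithm I W T) (x : I → Bool) (b : Bool) : ℝ :=
  ∑ s : QueryBasis I W, if A.output s = b then ‖A.state x (Fin.last T) s‖ ^ 2 else 0

end QuantumQueryAlgorithm

open Classical in
/-- The adjacency matrix of `G` as an input of a query algorithm. -/
noncomputable def adjacencyInput {V : Type} (G : SimpleGraph V) : VertexPair V → Bool :=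
  fun e => decide (e.1 ∈ G.edgeSet)

open Classical in
/-- The algorithm decides the graph property `P` with bounded error in the adjacency matrix model:
on every graph `G` it outputs the truth value of `P G` with probability at least `2 / 3`. -/
def QuantumQueryAlgorithm.DecidesWithBoundedError {V W : Type} [Fintype V] [DecidableEq V]
    [Fintype W] [DecidableEq W] {T : ℕ} (A : QuantumQueryAlgorithm (VertexPair V) W T)
    (P : SimpleGraph V → Prop) : Prop :=
  ∀ G : SimpleGraph V, 2 / 3 ≤ A.outputProb (adjacencyInput G) (decide (P G))

/-- `G` has a vertex cover of size at most `k`. -/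
def HasVertexCoverOfSizeAtMost {V : Type} (G : SimpleGraph V) (k : ℕ) : Prop :=
  ∃ S : Finset V, S.card ≤ k ∧ G.IsVertexCover (S : Set V)

open Matrix

/-! ### Query weights -/

namespace QuantumQueryAlgorithm

variable {I W : Type} [Fintype I] [Fintype W]

/-! The hard inputs are a clique `C` on `k - j + 1` vertices together with `j` or `j + 1` disjoint
edges outside it. A minimum vertex cover takes all but one vertex of `C` and one end of each
matching edge, so its size is `k` or `k + 1`. A matching of size `j` extends by any pair of free
vertices, and one of size `j + 1` shrinks in `j + 1` ways. With `j` about `εk/2`, linearly many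
vertices stay free even when `k` is close to `(1 - ε)n`, because the clique uses up the cover budget
with about one vertex per unit. The two degrees are then of order `n²` and `k`.

The adversary bound (`sqrt_mul_le_of_adversary`) turns degrees `d`, `d'` into `T ≥ √(d d') / 36`.
For each related pair of inputs the inner product of the two states starts at `1` and must end away
from `1`. One query moves it only by the weight on the single differing position. For a fixed input
these weights sum to at most `1` over all its neighbours, so summed over all pairs one query
achieves little. -/

theorem sum_queryBasis {M : Type*} [AddCommMonoid M] (f : QueryBasis I W → M) :
    ∑ s, f s = ∑ i, ∑ w, (f (i, false, w) + f (i, true, w)) := by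
  rw [Fintype.sum_prod_type]
  refine Finset.sum_congr rfl fun i _ => ?_
  rw [Fintype.sum_prod_type, Fintype.sum_bool, add_comm, Finset.sum_add_distrib]

/-- The query operator permutes the computational basis. -/
theorem sum_comp_query {M : Type*} [AddCommMonoid M] (x : I → Bool) (f : QueryBasis I W → M) :
    ∑ s : QueryBasis I W, f (s.1, s.2.1 ^^ x s.1, s.2.2) = ∑ s, f s := by
  rw [sum_queryBasis, sum_queryBasis]
  refine Finset.sum_congr rfl fun i _ => Finset.sum_congr rfl fun w _ => ?_
  cases x i <;> simp [add_comm]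

/-- The squared norm of the part of `ψ` that queries position `i`. -/
noncomputable def queryWeight {I : Type} (ψ : QueryBasis I W → ℂ) (i : I) : ℝ :=
  ∑ w, (‖ψ (i, false, w)‖ ^ 2 + ‖ψ (i, true, w)‖ ^ 2)

theorem queryWeight_nonneg {I : Type} (ψ : QueryBasis I W → ℂ) (i : I) : 0 ≤ queryWeight ψ i :=
  Finset.sum_nonneg fun _ _ => by positivity

theorem sum_queryWeight (ψ : QueryBasis I W → ℂ) : ∑ i, queryWeight ψ i = ∑ s, ‖ψ s‖ ^ 2 :=
  (sum_queryBasis fun s => ‖ψ s‖ ^ 2).symm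

variable [DecidableEq I]

/-- If in a set of pairs of a state index and a position every state index occurs at least `d`
times, then the average of the weights of the pairs is at most `1 / d`. -/
theorem mul_sum_queryWeight_le {ι κ : Type*} [DecidableEq κ] (R : Finset ι) (f : ι → κ)
    (g : ι → I) (hinj : ∀ r ∈ R, ∀ r' ∈ R, f r = f r' → g r = g r' → r = r') (d : ℕ)
    (hd : ∀ r ∈ R, d ≤ (R.filter fun r' => f r' = f r).card) (ψ : κ → QueryBasis I W → ℂ)
    (hψ : ∀ x, ∑ s, ‖ψ x s‖ ^ 2 = 1) :
    d * ∑ r ∈ R, queryWeight (ψ (f r)) (g r) ≤ R.card := by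
  -- Pairs with the same state index have distinct positions, so their weights add up to at most the
  -- squared norm `1` of that state.
  have h1 : ∑ r ∈ R, queryWeight (ψ (f r)) (g r) ≤ (R.image f).card := by
    rw [← Finset.sum_fiberwise_of_maps_to (t := R.image f) (g := f)
      (fun r hr => Finset.mem_image_of_mem f hr)]
    refine (Finset.sum_le_card_nsmul _ _ 1 fun x _ => ?_).trans (by simp)
    rw [← hψ x, ← sum_queryWeight]
    calc ∑ r ∈ R with f r = x, queryWeight (ψ (f r)) (g r)
        = ∑ r ∈ R with f r = x, queryWeight (ψ x) (g r) :=
          Finset.sum_congr rfl fun r hr => by rw [(Finset.mem_filter.1 hr).2]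
      _ = ∑ i ∈ (R.filter fun r => f r = x).image g, queryWeight (ψ x) i := by
          rw [Finset.sum_image]
          intro r hr r' hr' h
          rw [Finset.mem_coe, Finset.mem_filter] at hr hr'
          exact hinj r hr.1 r' hr'.1 (hr.2.trans hr'.2.symm) h
      _ ≤ ∑ i, queryWeight (ψ x) i :=
          Finset.sum_le_sum_of_subset_of_nonneg (Finset.subset_univ _)
            fun i _ _ => queryWeight_nonneg _ i
  have h2 : d * (R.image f).card ≤ R.card := by
    rw [Finset.card_eq_sum_card_image f R, mul_comm, ← smul_eq_mul]
    refine Finset.card_nsmul_le_sum _ _ _ fun x hx => ?_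
    obtain ⟨r, hr, rfl⟩ := Finset.mem_image.1 hx
    exact hd r hr
  calc (d : ℝ) * ∑ r ∈ R, queryWeight (ψ (f r)) (g r) ≤ d * (R.image f).card := by gcongr
    _ ≤ R.card := by exact_mod_cast h2

/-! ### Effect of queries and unitaries on inner products -/

variable [DecidableEq W]

theorem queryOracle_mulVec (x : I → Bool) (ψ : QueryBasis I W → ℂ) (s : QueryBasis I W) :
    (queryOracle x *ᵥ ψ) s = ψ (s.1, s.2.1 ^^ x s.1, s.2.2) := by
  rw [Matrix.mulVec, dotProduct, Finset.sum_eq_single (s.1, s.2.1 ^^ x s.1, s.2.2)]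
  · simp [queryOracle]
  · rintro ⟨i, q, w⟩ - h
    have : ¬ s = (i, q ^^ x i, w) := by
      rintro rfl
      simp at h
    simp [queryOracle, this]
  · simp

theorem star_dotProduct_queryOracle (x : I → Bool) (ψ φ : QueryBasis I W → ℂ) :
    star (queryOracle x *ᵥ ψ) ⬝ᵥ (queryOracle x *ᵥ φ) = star ψ ⬝ᵥ φ := by
  simp only [dotProduct, Pi.star_apply, queryOracle_mulVec]
  exact sum_comp_query x fun s => star (ψ s) * φ s

theorem star_dotProduct_unitary {n : Type} [Fintype n] [DecidableEq n]
    (U : Matrix.unitaryGroup n ℂ) (ψ φ : n → ℂ) :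
    star ((U : Matrix n n ℂ) *ᵥ ψ) ⬝ᵥ ((U : Matrix n n ℂ) *ᵥ φ) = star ψ ⬝ᵥ φ := by
  rw [Matrix.star_mulVec, Matrix.dotProduct_mulVec, Matrix.vecMul_vecMul,
    ← Matrix.star_eq_conjTranspose, Unitary.coe_star_mul_self, Matrix.vecMul_one]

theorem star_dotProduct_self {n : Type} [Fintype n] (ψ : n → ℂ) :
    star ψ ⬝ᵥ ψ = ((∑ s, ‖ψ s‖ ^ 2 : ℝ) : ℂ) := by
  simp [dotProduct, Complex.conj_mul']

/-- A query changes the inner product of two states only through the parts that query a position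
where the inputs differ. -/
theorem norm_sub_queryOracle_le {x y : I → Bool} {e : I} (hxy : ∀ i, i ≠ e → x i = y i)
    {α β : ℝ} (hα : 0 < α) (hαβ : α * β = 1) (ψ φ : QueryBasis I W → ℂ) :
    ‖star ψ ⬝ᵥ φ - star (queryOracle x *ᵥ ψ) ⬝ᵥ (queryOracle y *ᵥ φ)‖ ≤
      α * queryWeight ψ e + β * queryWeight φ e := by
  have key : ∀ a b : ℝ, a * b ≤ (α * a ^ 2 + β * b ^ 2) / 2 := by
    intro a b
    have h : 0 ≤ α * (a - β * b) ^ 2 := by positivity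
    have h2 : α * (a - β * b) ^ 2 = α * a ^ 2 - 2 * (α * β) * (a * b) + (α * β) * (β * b ^ 2) := by
      ring
    rw [h2, hαβ] at h
    linarith
  have hβ : 0 < β := by
    by_contra h
    nlinarith
  -- With `x` queried on both sides of the first inner product, the difference is that of `O_x ψ`
  -- with `(O_x - O_y) φ`, and the latter vanishes off position `e`.
  rw [← star_dotProduct_queryOracle x ψ φ, ← dotProduct_sub]
  simp only [dotProduct, Pi.star_apply, Pi.sub_apply, queryOracle_mulVec]
  rw [sum_queryBasis, Finset.sum_eq_single e]
  · rw [queryWeight, queryWeight, Finset.mul_sum, Finset.mul_sum, ← Finset.sum_add_distrib]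
    refine (norm_sum_le _ _).trans (Finset.sum_le_sum fun w _ => ?_)
    have hp : ∀ a b c d : ℂ, ‖star a * (b - c) + star d * (c - b)‖ ≤
        α * (‖a‖ ^ 2 + ‖d‖ ^ 2) + β * (‖b‖ ^ 2 + ‖c‖ ^ 2) := by
      intro a b c d
      refine (norm_add_le _ _).trans ?_
      rw [norm_mul, norm_mul, norm_star, norm_star]
      have h1 := mul_le_mul_of_nonneg_left (norm_sub_le b c) (norm_nonneg a)
      have h2 := mul_le_mul_of_nonneg_left (norm_sub_le c b) (norm_nonneg d)
      have := key ‖a‖ ‖b‖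
      have := key ‖a‖ ‖c‖
      have := key ‖d‖ ‖b‖
      have := key ‖d‖ ‖c‖
      linarith
    have h1 := hp (ψ (e, false, w)) (φ (e, false, w)) (φ (e, true, w)) (ψ (e, true, w))
    have h2 := hp (ψ (e, true, w)) (φ (e, true, w)) (φ (e, false, w)) (ψ (e, false, w))
    have h0 : 0 ≤ α * (‖ψ (e, false, w)‖ ^ 2 + ‖ψ (e, true, w)‖ ^ 2) +
        β * (‖φ (e, false, w)‖ ^ 2 + ‖φ (e, true, w)‖ ^ 2) := by positivity
    cases x e <;> cases y e <;> simp only [Bool.not_false, bne_self_eq_false,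
      Bool.xor_false, Bool.xor_true, sub_self, mul_zero, add_zero, norm_zero] <;> first | exact h0 | linarith
  · intro i _ hi
    simp [hxy i hi]
  · simp

/-! ### Evolution of the states and the adversary bound -/

variable {T : ℕ} (A : QuantumQueryAlgorithm I W T)

theorem state_zero (x : I → Bool) : A.state x 0 =
    (A.U 0 : Matrix (QueryBasis I W) (QueryBasis I W) ℂ) *ᵥ Pi.single A.start 1 := rfl

theorem state_succ (x : I → Bool) (t : Fin T) : A.state x t.succ =
    (A.U t.succ : Matrix (QueryBasis I W) (QueryBasis I W) ℂ) *ᵥ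
      (queryOracle x *ᵥ A.state x t.castSucc) := rfl

theorem star_dotProduct_state_self (x : I → Bool) (t : Fin (T + 1)) :
    star (A.state x t) ⬝ᵥ A.state x t = 1 := by
  induction t using Fin.induction with
  | zero =>
    rw [state_zero, star_dotProduct_unitary]
    simp
  | succ t ih => rw [state_succ, star_dotProduct_unitary, star_dotProduct_queryOracle, ih]

theorem sum_norm_sq_state (x : I → Bool) (t : Fin (T + 1)) : ∑ s, ‖A.state x t s‖ ^ 2 = 1 := by
  have h := A.star_dotProduct_state_self x t
  rw [star_dotProduct_self] at h
  exact_mod_cast h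

/-- The states on two inputs that differ in one position drift apart by at most the weight with
which that position is queried. -/
theorem norm_one_sub_state_le {x y : I → Bool} {e : I} (hxy : ∀ i, i ≠ e → x i = y i)
    {α β : ℝ} (hα : 0 < α) (hαβ : α * β = 1) :
    ‖1 - star (A.state x (Fin.last T)) ⬝ᵥ A.state y (Fin.last T)‖ ≤
      ∑ t : Fin T, (α * queryWeight (A.state x t.castSucc) e +
        β * queryWeight (A.state y t.castSucc) e) := by
  have hd : 1 - star (A.state x (Fin.last T)) ⬝ᵥ A.state y (Fin.last T) =
      ∑ t : Fin T, (star (A.state x t.castSucc) ⬝ᵥ A.state y t.castSucc -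
        star (A.state x t.succ) ⬝ᵥ A.state y t.succ) := by
    have h0 : star (A.state x 0) ⬝ᵥ A.state y 0 = 1 := A.star_dotProduct_state_self x 0
    have h1 := Fin.sum_univ_succ fun t => star (A.state x t) ⬝ᵥ A.state y t
    have h2 := Fin.sum_univ_castSucc fun t => star (A.state x t) ⬝ᵥ A.state y t
    rw [Finset.sum_sub_distrib]
    linear_combination h2 - h1 - h0
  rw [hd]
  refine (norm_sum_le _ _).trans (Finset.sum_le_sum fun t _ => ?_)
  rw [state_succ, state_succ, star_dotProduct_unitary]
  exact norm_sub_queryOracle_le hxy hα hαβ _ _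

theorem outputProb_true_add_false (x : I → Bool) :
    A.outputProb x true + A.outputProb x false = 1 := by
  rw [← A.sum_norm_sq_state x (Fin.last T), outputProb, outputProb, ← Finset.sum_add_distrib]
  refine Finset.sum_congr rfl fun s _ => ?_
  cases A.output s <;> simp

/-- States that a measurement tells apart have inner product bounded away from `1`. -/
theorem norm_dotProduct_state_le {x y : I → Bool} (hx : 2 / 3 ≤ A.outputProb x true)
    (hy : 2 / 3 ≤ A.outputProb y false) :
    ‖star (A.state x (Fin.last T)) ⬝ᵥ A.state y (Fin.last T)‖ ≤ 17 / 18 := by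
  have hx1 := A.outputProb_true_add_false x
  have hy1 := A.outputProb_true_add_false y
  -- Weighted AM-GM, valid since `3/8 · 2/3 = 1/4`; the larger weight goes to the state for which
  -- the outcome is wrong. Success probability `2/3` gives `2 (3/8 · 2/3 + 2/3 · 1/3) = 17/18`.
  have h : ‖star (A.state x (Fin.last T)) ⬝ᵥ A.state y (Fin.last T)‖ ≤
      3 / 8 * A.outputProb x true + 2 / 3 * A.outputProb x false +
        (2 / 3 * A.outputProb y true + 3 / 8 * A.outputProb y false) := by
    simp only [outputProb, Finset.mul_sum, ← Finset.sum_add_distrib, dotProduct]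
    refine (norm_sum_le _ _).trans (Finset.sum_le_sum fun s _ => ?_)
    rw [norm_mul, Pi.star_apply, norm_star]
    cases A.output s <;> simp <;>
      nlinarith [sq_nonneg (3 * ‖A.state x (Fin.last T) s‖ - 4 * ‖A.state y (Fin.last T) s‖),
        sq_nonneg (4 * ‖A.state x (Fin.last T) s‖ - 3 * ‖A.state y (Fin.last T) s‖)]
  linarith

/-- The adversary bound for pairs of inputs that differ in a single position. -/
theorem sqrt_mul_le_of_adversary {ι : Type*} (R : Finset ι) (hR : R.Nonempty)
    (x y : ι → I → Bool) (e : ι → I) (hxy : ∀ r ∈ R, ∀ i, i ≠ e r → x r i = y r i)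
    (hinjx : ∀ r ∈ R, ∀ r' ∈ R, x r = x r' → e r = e r' → r = r')
    (hinjy : ∀ r ∈ R, ∀ r' ∈ R, y r = y r' → e r = e r' → r = r') (d d' : ℕ) (hd0 : 0 < d)
    (hd0' : 0 < d') (hd : ∀ r ∈ R, d ≤ (R.filter fun r' => x r' = x r).card)
    (hd' : ∀ r ∈ R, d' ≤ (R.filter fun r' => y r' = y r).card)
    (hx : ∀ r ∈ R, 2 / 3 ≤ A.outputProb (x r) true)
    (hy : ∀ r ∈ R, 2 / 3 ≤ A.outputProb (y r) false) :
    Real.sqrt (d * d') ≤ 36 * T := by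
  have hdr : (0 : ℝ) < d := by exact_mod_cast hd0
  have hdr' : (0 : ℝ) < d' := by exact_mod_cast hd0'
  set a := Real.sqrt d with ha
  set b := Real.sqrt d' with hb
  have ha0 : 0 < a := Real.sqrt_pos.2 hdr
  have hb0 : 0 < b := Real.sqrt_pos.2 hdr'
  have haa : a * a = d := Real.mul_self_sqrt hdr.le
  have hbb : b * b = d' := Real.mul_self_sqrt hdr'.le
  have hR0 : (0 : ℝ) < R.card := by exact_mod_cast hR.card_pos
  rw [Real.sqrt_mul hdr.le, ← ha, ← hb]
  have hlow : ∀ r ∈ R, (1 / 18 : ℝ) ≤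
      ∑ t : Fin T, (a / b * queryWeight (A.state (x r) t.castSucc) (e r) +
        b / a * queryWeight (A.state (y r) t.castSucc) (e r)) := by
    intro r hr
    refine le_trans ?_ (A.norm_one_sub_state_le (hxy r hr) (α := a / b) (β := b / a)
      (by positivity) (by field_simp))
    have h1 := A.norm_dotProduct_state_le (hx r hr) (hy r hr)
    have h2 := norm_sub_norm_le (1 : ℂ)
      (star (A.state (x r) (Fin.last T)) ⬝ᵥ A.state (y r) (Fin.last T))
    rw [norm_one] at h2
    linarith
  -- The two weight sums are at most `|R| / d` and `|R| / d'`; the factors `a / b` and `b / a`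
  -- balance them, each contributing `|R| / √(d d')`.
  have hstep : ∀ t : Fin T, ∑ r ∈ R, (a / b * queryWeight (A.state (x r) t.castSucc) (e r) +
      b / a * queryWeight (A.state (y r) t.castSucc) (e r)) ≤ 2 * R.card / (a * b) := by
    intro t
    have h1 := mul_sum_queryWeight_le R x e hinjx d hd (fun x => A.state x t.castSucc)
      fun x => A.sum_norm_sq_state x _
    have h2 := mul_sum_queryWeight_le R y e hinjy d' hd' (fun x => A.state x t.castSucc)
      fun x => A.sum_norm_sq_state x _
    rw [Finset.sum_add_distrib, ← Finset.mul_sum, ← Finset.mul_sum, le_div_iff₀ (by positivity)]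
    rw [← haa] at h1
    rw [← hbb] at h2
    generalize ∑ r ∈ R, queryWeight (A.state (x r) t.castSucc) (e r) = p at *
    generalize ∑ r ∈ R, queryWeight (A.state (y r) t.castSucc) (e r) = q at *
    have : (a / b * p + b / a * q) * (a * b) = a * a * p + b * b * q := by field_simp
    linarith
  have h1 : (R.card : ℝ) * (1 / 18) ≤ T * (2 * R.card / (a * b)) := by
    calc (R.card : ℝ) * (1 / 18) = ∑ r ∈ R, (1 / 18 : ℝ) := by
          rw [Finset.sum_const, nsmul_eq_mul]
      _ ≤ _ := Finset.sum_le_sum hlow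
      _ = _ := Finset.sum_comm
      _ ≤ ∑ t : Fin T, 2 * R.card / (a * b) := Finset.sum_le_sum fun t _ => hstep t
      _ = _ := by simp
  rw [← mul_div_assoc (T : ℝ), le_div_iff₀ (by positivity)] at h1
  refine le_of_mul_le_mul_left ?_ hR0
  linarith

end QuantumQueryAlgorithm

/-! ### Cliques with disjoint edges outside -/

section VertexCover

variable {V : Type}

/-- The complete graph on `C` together with the edges in `M`. -/
def cliqueSupEdges (C : Finset V) (M : Finset (VertexPair V)) : SimpleGraph V where
  Adj u v := u ≠ v ∧ ((u ∈ C ∧ v ∈ C) ∨ ∃ e ∈ M, e.1 = s(u, v))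
  symm.symm _ _ h := ⟨h.1.symm, h.2.imp And.symm fun ⟨e, he, h⟩ => ⟨e, he, h.trans Sym2.eq_swap⟩⟩
  loopless.irrefl _ h := h.1 rfl

/-- The pairs in `M` are pairwise disjoint and avoid `C`. -/
def IsMatchingOutside (C : Finset V) (M : Finset (VertexPair V)) : Prop :=
  (∀ e ∈ M, ∀ v ∈ e.1, v ∉ C) ∧ ∀ e ∈ M, ∀ e' ∈ M, ∀ v, v ∈ e.1 → v ∈ e'.1 → e = e'

theorem IsMatchingOutside.mono {C : Finset V} {M N : Finset (VertexPair V)}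
    (h : IsMatchingOutside C N) (hMN : M ⊆ N) : IsMatchingOutside C M :=
  ⟨fun e he => h.1 e (hMN he), fun e he e' he' => h.2 e (hMN he) e' (hMN he')⟩

theorem adjacencyInput_cliqueSupEdges (C : Finset V) (M : Finset (VertexPair V))
    (e : VertexPair V) :
    adjacencyInput (cliqueSupEdges C M) e = true ↔ (∀ v ∈ e.1, v ∈ C) ∨ e ∈ M := by
  obtain ⟨e, he⟩ := e
  induction e using Sym2.ind with
  | _ u v =>
    have huv : u ≠ v := by simpa using he
    have hM : (∃ e ∈ M, e.1 = s(u, v)) ↔ (⟨s(u, v), he⟩ : VertexPair V) ∈ M :=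
      ⟨fun ⟨e, h, h'⟩ => by
        have : e = ⟨s(u, v), he⟩ := Subtype.ext h'
        exact this ▸ h, fun h => ⟨_, h, rfl⟩⟩
    refine (@decide_eq_true_iff _ (Classical.propDecidable _)).trans ?_
    rw [SimpleGraph.mem_edgeSet]
    simp only [cliqueSupEdges, Sym2.mem_iff, forall_eq_or_imp, forall_eq, hM]
    exact and_iff_right huv

/-- A pair avoiding `C` is an edge only if it lies in the matching, so the graph determines the
matching. This supplies the injectivity hypotheses of the adversary bound. -/
theorem adjacencyInput_cliqueSupEdges_injOn (C : Finset V) {M N : Finset (VertexPair V)}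
    (hM : IsMatchingOutside C M) (hN : IsMatchingOutside C N)
    (h : adjacencyInput (cliqueSupEdges C M) = adjacencyInput (cliqueSupEdges C N)) : M = N := by
  have key : ∀ {M N : Finset (VertexPair V)}, IsMatchingOutside C M →
      adjacencyInput (cliqueSupEdges C M) = adjacencyInput (cliqueSupEdges C N) → M ⊆ N := by
    intro M N hM h e he
    have h1 := (adjacencyInput_cliqueSupEdges C M e).2 (Or.inr he)
    rw [h] at h1
    refine ((adjacencyInput_cliqueSupEdges C N e).1 h1).resolve_left fun hC => ?_
    have hm := e.1.out_fst_mem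
    exact hM.1 e he _ hm (hC _ hm)
  exact (key hM h).antisymm (key hN h.symm)

variable [DecidableEq V]

theorem adjacencyInput_cliqueSupEdges_insert (C : Finset V) (M : Finset (VertexPair V))
    {e i : VertexPair V} (hi : i ≠ e) :
    adjacencyInput (cliqueSupEdges C M) i = adjacencyInput (cliqueSupEdges C (insert e M)) i := by
  rw [Bool.eq_iff_iff, adjacencyInput_cliqueSupEdges, adjacencyInput_cliqueSupEdges,
    Finset.mem_insert, or_iff_right hi]

/-- All of `C` but one vertex, with one end of each pair in `M`, is a cover. -/
theorem hasVertexCover_cliqueSupEdges {C : Finset V} (hC : C.Nonempty)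
    (M : Finset (VertexPair V)) :
    HasVertexCoverOfSizeAtMost (cliqueSupEdges C M) (C.card - 1 + M.card) := by
  obtain ⟨c, hc⟩ := hC
  refine ⟨C.erase c ∪ M.image fun e => e.1.out.1, ?_, ?_⟩
  · refine (Finset.card_union_le _ _).trans ?_
    rw [Finset.card_erase_of_mem hc]
    exact Nat.add_le_add_left Finset.card_image_le _
  · rintro u v ⟨huv, ⟨hu, hv⟩ | ⟨e, he, h⟩⟩
    · by_cases h : u = c
      · exact Or.inr (by simp [hv, h ▸ huv.symm])
      · exact Or.inl (by simp [hu, h])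
    · have hm : e.1.out.1 ∈ M.image fun e => e.1.out.1 := Finset.mem_image_of_mem _ he
      have h1 : e.1.out.1 ∈ s(u, v) := h ▸ e.1.out_fst_mem
      rw [Sym2.mem_iff] at h1
      rcases h1 with h1 | h1
      · exact Or.inl (Finset.mem_coe.2 (Finset.mem_union_right _ (h1 ▸ hm)))
      · exact Or.inr (Finset.mem_coe.2 (Finset.mem_union_right _ (h1 ▸ hm)))

/-- A cover misses at most one vertex of the clique and contains an end of each matching edge; these
ends are distinct and lie outside `C`. -/
theorem IsMatchingOutside.le_of_hasVertexCover {C : Finset V} {M : Finset (VertexPair V)}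
    (hM : IsMatchingOutside C M) {k : ℕ}
    (h : HasVertexCoverOfSizeAtMost (cliqueSupEdges C M) k) : C.card - 1 + M.card ≤ k := by
  obtain ⟨S, hS, hcov⟩ := h
  have h1 : (C \ S).card ≤ 1 := by
    refine Finset.card_le_one.2 fun u hu v hv => ?_
    by_contra huv
    rw [Finset.mem_sdiff] at hu hv
    have hadj : (cliqueSupEdges C M).Adj u v := ⟨huv, Or.inl ⟨hu.1, hv.1⟩⟩
    rcases hcov hadj with h | h
    · exact hu.2 h
    · exact hv.2 h
  -- For pairs not in `M` any end serves, so that `choose` gives a total function.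
  have h2 : ∀ e : VertexPair V, ∃ v, v ∈ e.1 ∧ (e ∈ M → v ∈ S) := by
    intro e
    by_cases he : e ∈ M
    swap
    · exact ⟨_, e.1.out_fst_mem, fun h => absurd h he⟩
    obtain ⟨e, he'⟩ := e
    induction e using Sym2.ind with
    | _ u v =>
      have hadj : (cliqueSupEdges C M).Adj u v := ⟨by simpa using he', Or.inr ⟨_, he, rfl⟩⟩
      rcases hcov hadj with h | h
      · exact ⟨u, by simp, fun _ => h⟩
      · exact ⟨v, by simp, fun _ => h⟩
  choose f hf hfS using h2
  have h3 : M.card ≤ (S \ C).card := Finset.card_le_card_of_injOn f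
    (fun e he => Finset.mem_coe.2 (Finset.mem_sdiff.2 ⟨hfS e he, hM.1 e he _ (hf e)⟩))
    fun e he e' he' h => hM.2 e he e' he' _ (hf e) (h ▸ hf e')
  have h4 := Finset.card_sdiff_add_card_inter C S
  have h5 := Finset.card_sdiff_add_card_inter S C
  rw [Finset.inter_comm] at h5
  omega

/-! ### Extending matchings and counting the extensions -/

variable [Fintype V]

/-- The vertices that are neither in `C` nor on a pair in `M`. -/
def freeVertices (C : Finset V) (M : Finset (VertexPair V)) : Finset V :=
  (C ∪ M.biUnion fun e => e.1.toFinset)ᶜ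

theorem mem_freeVertices {C : Finset V} {M : Finset (VertexPair V)} {v : V} :
    v ∈ freeVertices C M ↔ v ∉ C ∧ ∀ e ∈ M, v ∉ e.1 := by
  simp only [freeVertices, Finset.mem_compl, Finset.mem_union, Finset.mem_biUnion,
    Sym2.mem_toFinset, not_or, not_exists, not_and]

theorem le_card_freeVertices (C : Finset V) (M : Finset (VertexPair V)) :
    Fintype.card V - C.card - 2 * M.card ≤ (freeVertices C M).card := by
  have h1 : (M.biUnion fun e => e.1.toFinset).card ≤ M.card * 2 :=
    Finset.card_biUnion_le_card_mul _ _ _ fun e _ => (Sym2.card_toFinset_of_not_isDiag e.1 e.2).le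
  have h2 := Finset.card_union_le C (M.biUnion fun e => e.1.toFinset)
  rw [freeVertices, Finset.card_compl]
  omega

/-- The pairs by which the matching `M` outside `C` can be extended. -/
def freePairs (C : Finset V) (M : Finset (VertexPair V)) : Finset (VertexPair V) :=
  Finset.univ.filter fun e => ∀ v ∈ e.1, v ∈ freeVertices C M

theorem le_card_freePairs (C : Finset V) (M : Finset (VertexPair V)) :
    (Fintype.card V - C.card - 2 * M.card).choose 2 ≤ (freePairs C M).card := by
  refine (Nat.choose_le_choose 2 (le_card_freeVertices C M)).trans ?_
  rw [← Sym2.card_image_offDiag]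
  refine (Finset.card_le_card fun e he => ?_).trans
    (Finset.card_image_le (s := freePairs C M) (f := Subtype.val))
  obtain ⟨⟨u, v⟩, huv, rfl⟩ := Finset.mem_image.1 he
  rw [Finset.mem_offDiag] at huv
  refine Finset.mem_image.2 ⟨⟨s(u, v), by simpa using huv.2.2⟩, ?_, rfl⟩
  refine Finset.mem_filter.2 ⟨Finset.mem_univ _, fun w hw => ?_⟩
  rcases Sym2.mem_iff.1 hw with rfl | rfl
  · exact huv.1
  · exact huv.2.1

theorem notMem_of_mem_freePairs {C : Finset V} {M : Finset (VertexPair V)} {e : VertexPair V}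
    (he : e ∈ freePairs C M) : e ∉ M := fun h =>
  (mem_freeVertices.1 ((Finset.mem_filter.1 he).2 _ e.1.out_fst_mem)).2 e h e.1.out_fst_mem

theorem IsMatchingOutside.insert {C : Finset V} {M : Finset (VertexPair V)}
    (hM : IsMatchingOutside C M) {e : VertexPair V} (he : e ∈ freePairs C M) :
    IsMatchingOutside C (insert e M) := by
  have hfree := fun v hv => mem_freeVertices.1 ((Finset.mem_filter.1 he).2 v hv)
  refine ⟨fun e' he' v hv => ?_, fun e₁ h₁ e₂ h₂ v hv₁ hv₂ => ?_⟩
  · rcases Finset.mem_insert.1 he' with rfl | he'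
    · exact (hfree v hv).1
    · exact hM.1 e' he' v hv
  · rcases Finset.mem_insert.1 h₁ with rfl | h₁' <;> rcases Finset.mem_insert.1 h₂ with rfl | h₂'
    · rfl
    · exact absurd hv₂ ((hfree v hv₁).2 _ h₂')
    · exact absurd hv₁ ((hfree v hv₂).2 _ h₁')
    · exact hM.2 e₁ h₁' e₂ h₂' v hv₁ hv₂

theorem exists_isMatchingOutside (C : Finset V) (j : ℕ)
    (hj : C.card + 2 * j ≤ Fintype.card V) :
    ∃ M : Finset (VertexPair V), M.card = j ∧ IsMatchingOutside C M := by
  induction j with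
  | zero => exact ⟨∅, rfl, by simp [IsMatchingOutside]⟩
  | succ j ih =>
    obtain ⟨M, hcard, hM⟩ := ih (by omega)
    have h := le_card_freePairs C M
    have hpos : 0 < (Fintype.card V - C.card - 2 * M.card).choose 2 := Nat.choose_pos (by omega)
    obtain ⟨e, he⟩ := Finset.card_pos.1 (hpos.trans_le h)
    exact ⟨Insert.insert e M,
      by rw [Finset.card_insert_of_notMem (notMem_of_mem_freePairs he), hcard], hM.insert he⟩

/-- The adversary bound for the complete graph on `C` together with `j` or `j + 1` disjoint edges
outside `C`. -/
theorem QuantumQueryAlgorithm.sqrt_le_of_decides_vertexCover {W : Type} [Fintype W]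
    [DecidableEq W] {T k : ℕ} (A : QuantumQueryAlgorithm (VertexPair V) W T)
    (hA : A.DecidesWithBoundedError fun G => HasVertexCoverOfSizeAtMost G k)
    {C : Finset V} (hC : C.Nonempty) {j : ℕ} (hk : C.card - 1 + j = k)
    (hj : C.card + 2 * (j + 1) ≤ Fintype.card V) :
    Real.sqrt (((Fintype.card V - C.card - 2 * j).choose 2 : ℕ) * ((j + 1 : ℕ) : ℝ)) ≤
      36 * T := by
  classical
  -- A related pair of inputs is encoded as the smaller matching and the edge added to it.
  set R : Finset (Finset (VertexPair V) × VertexPair V) :=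
    Finset.univ.filter fun r => r.1.card = j ∧ r.2 ∉ r.1 ∧ IsMatchingOutside C (insert r.2 r.1)
    with hRdef
  have hR : ∀ r, r ∈ R ↔ r.1.card = j ∧ r.2 ∉ r.1 ∧ IsMatchingOutside C (insert r.2 r.1) :=
    fun r => by simp [hRdef]
  have hmat : ∀ r ∈ R, IsMatchingOutside C r.1 := fun r hr =>
    ((hR r).1 hr).2.2.mono (Finset.subset_insert _ _)
  have herase : ∀ N : Finset (VertexPair V), N.card = j + 1 → IsMatchingOutside C N →
      ∀ e ∈ N, (N.erase e, e) ∈ R := fun N hN hmN e he =>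
    (hR _).2 ⟨by simp [Finset.card_erase_of_mem he, hN], by simp,
      by rwa [Finset.insert_erase he]⟩
  refine A.sqrt_mul_le_of_adversary R ?_ (fun r => adjacencyInput (cliqueSupEdges C r.1))
    (fun r => adjacencyInput (cliqueSupEdges C (insert r.2 r.1))) Prod.snd
    (fun r _ i hi => adjacencyInput_cliqueSupEdges_insert C r.1 hi) ?_ ?_ _ _
    (Nat.choose_pos (by omega)) (Nat.succ_pos j) ?_ ?_ ?_ ?_
  · obtain ⟨N, hN, hmN⟩ := exists_isMatchingOutside C (j + 1) hj
    obtain ⟨e, he⟩ := Finset.card_pos.1 (by omega : 0 < N.card)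
    exact ⟨_, herase N hN hmN e he⟩
  · intro r hr r' hr' h he
    exact Prod.ext (adjacencyInput_cliqueSupEdges_injOn C (hmat r hr) (hmat r' hr') h) he
  · intro r hr r' hr' h he
    have h1 := adjacencyInput_cliqueSupEdges_injOn C ((hR r).1 hr).2.2 ((hR r').1 hr').2.2 h
    refine Prod.ext ?_ he
    rw [← Finset.erase_insert ((hR r).1 hr).2.1, h1, he,
      Finset.erase_insert ((hR r').1 hr').2.1]
  -- Degree of a yes-input: every free pair extends the matching.
  · intro r hr
    rw [← ((hR r).1 hr).1]
    refine (le_card_freePairs C r.1).trans ?_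
    refine Finset.card_le_card_of_injOn (fun e => (r.1, e)) (fun e he => ?_)
      fun e _ e' _ h => (Prod.ext_iff.1 h).2
    exact Finset.mem_coe.2 (Finset.mem_filter.2 ⟨(hR _).2 ⟨((hR r).1 hr).1,
      notMem_of_mem_freePairs he, (hmat r hr).insert he⟩, rfl⟩)
  -- Degree of a no-input: any of the `j + 1` edges may be the one removed.
  · intro r hr
    obtain ⟨h1, h2, h3⟩ := (hR r).1 hr
    have hcard : (insert r.2 r.1).card = j + 1 := by
      rw [Finset.card_insert_of_notMem h2, h1]
    rw [← hcard]
    refine Finset.card_le_card_of_injOn (fun e => ((insert r.2 r.1).erase e, e)) (fun e he => ?_)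
      fun e _ e' _ h => (Prod.ext_iff.1 h).2
    refine Finset.mem_coe.2 (Finset.mem_filter.2 ⟨herase _ hcard h3 e he, ?_⟩)
    simp only [Finset.insert_erase (Finset.mem_coe.1 he)]
  · intro r hr
    have h := hA (cliqueSupEdges C r.1)
    have hP := hasVertexCover_cliqueSupEdges hC r.1
    rw [((hR r).1 hr).1, hk] at hP
    rwa [decide_eq_true hP] at h
  · intro r hr
    obtain ⟨h1, h2, h3⟩ := (hR r).1 hr
    have h := hA (cliqueSupEdges C (insert r.2 r.1))
    have hP : ¬ HasVertexCoverOfSizeAtMost (cliqueSupEdges C (insert r.2 r.1)) k := by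
      intro hP
      have := h3.le_of_hasVertexCover hP
      rw [Finset.card_insert_of_notMem h2, h1] at this
      omega
    rwa [decide_eq_false hP] at h

end VertexCover

/-! ### Choice of the clique and matching sizes -/

theorem theorem2 (ε : ℝ) (hε : 0 < ε) :
    ∃ c : ℝ, 0 < c ∧ ∃ n₀ : ℕ, ∀ n : ℕ, n₀ ≤ n → ∀ k : ℕ, (k : ℝ) ≤ (1 - ε) * n →
      ∀ (W : Type) [Fintype W] [DecidableEq W] (T : ℕ)
        (A : QuantumQueryAlgorithm (VertexPair (Fin n)) W T),
        A.DecidesWithBoundedError (fun G => HasVertexCoverOfSizeAtMost G k) →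
          c * (Real.sqrt k * n) ≤ T := by
  refine ⟨ε / 8 * Real.sqrt (ε / 2) / 36, by positivity, ⌈16 / ε⌉₊, ?_⟩
  intro n hn k hk W _ _ T A hA
  rcases Nat.eq_zero_or_pos k with rfl | hk0
  · simp
  have hkr : (1 : ℝ) ≤ k := by exact_mod_cast hk0
  have hnε : 16 ≤ ε * n := by
    have := (div_le_iff₀ hε).1 (Nat.ceil_le.1 hn)
    linarith
  have hn0 : (0 : ℝ) ≤ n := Nat.cast_nonneg n
  have hε1 : ε < 1 := by
    by_contra h
    nlinarith
  -- Large enough that `j` is of order `k`, small enough that `k + j ≤ (1 - ε/2) n + 1`; the bound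
  -- `16 ≤ ε n` absorbs the additive constants.
  set j := ⌈ε * k / 2⌉₊ with hj
  have hj1 : ε * k / 2 ≤ j := Nat.le_ceil _
  have hj2 : (j : ℝ) < ε * k / 2 + 1 := Nat.ceil_lt_add_one (by positivity)
  have hjk : j ≤ k := Nat.ceil_le.2 (by nlinarith)
  have hkn : ε * k ≤ ε * n := by
    refine mul_le_mul_of_nonneg_left ?_ hε.le
    nlinarith
  have hroom : ε * n / 2 - 2 ≤ (n : ℝ) - k - j - 1 := by linarith
  have hle : k + j + 3 ≤ n := by
    have : ((k + j + 3 : ℕ) : ℝ) ≤ n := by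
      push_cast
      linarith
    exact_mod_cast this
  obtain ⟨C, -, hC⟩ := Finset.exists_subset_card_eq (s := (Finset.univ : Finset (Fin n)))
    (n := k - j + 1) (by simp; omega)
  have hmain := A.sqrt_le_of_decides_vertexCover hA (C := C) (Finset.card_pos.1 (by omega))
    (j := j) (by omega) (by simp; omega)
  -- Since `|C| + 2j = k + j + 1`, exactly `m + 2` vertices are free, which avoids truncated
  -- subtraction.
  obtain ⟨m, hm⟩ := Nat.exists_eq_add_of_le hle
  have hm' : Fintype.card (Fin n) - C.card - 2 * j = m + 2 := by
    rw [Fintype.card_fin, hC]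
    omega
  have hmr : ε * n / 4 ≤ (m : ℝ) + 2 := by
    have : (n : ℝ) = k + j + 3 + m := by exact_mod_cast hm
    linarith
  rw [hm'] at hmain
  -- With `a = ε n / 8 ≥ 2`, the bounds `m + 2 ≥ 2a` and `m + 1 ≥ a` give `(m + 2)(m + 1) / 2 ≥ a²`.
  have hle2 : (ε * n / 8) ^ 2 * (ε / 2 * k) ≤ ((m + 2).choose 2 : ℕ) * ((j + 1 : ℕ) : ℝ) := by
    rw [Nat.cast_choose_two]
    push_cast
    refine mul_le_mul ?_ (by linarith) (by positivity) ?_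
    · nlinarith [(Nat.cast_nonneg m : (0 : ℝ) ≤ m)]
    · nlinarith [(Nat.cast_nonneg m : (0 : ℝ) ≤ m)]
  have h := (Real.sqrt_le_sqrt hle2).trans hmain
  rw [Real.sqrt_mul (by positivity), Real.sqrt_sq (by positivity),
    Real.sqrt_mul (by positivity)] at h
  linarith
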